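/- Let $E=(E^0,E^1,r,s)$ be an arbitrary directed graph (any sets of vertices and edges; loops, parallel edges, sinks and infinite emitters are allowed), and let $F$ be an infinite field. Let $L_F(E)$ be the Leavitt path algebra of $E$, that is, the universal associative (not necessarily unital) $F$-algebra generated by pairwise orthogonal idempotents $\{p_v : v\in E^0\}$ and elements $\{x_e,y_e : e\in E^1\}$ subject to (1) $p_{s(e)}x_e=x_e=x_ep_{r(e)}$ for $e\in E^1$; (2) $p_{r(e)}y_e=y_e=y_ep_{s(e)}$ for $e\in E^1$; (3) $y_ex_f=\delta_{e,f}\,p_{r(e)}$ for $e,f\in E^1$; (4) $p_v=\sum_{e\in s^{-1}(v)}x_ey_e$ for every $v\in E^0$ with $0<|s^{-1}(v)|<\infty$. For $t\in F^*=F\setminus\{0\}$ let $\tau^E_t$ be the $F$-algebra automorphism of $L_F(E)$ with $\tau^E_t(p_v)=p_v$, $\tau^E_t(x_e)=t^{-1}x_e$ and $\tau^E_t(y_e)=t\,y_e$ for all $v\in E^0$, $e\in E^1$; the group homomorphism $\tau^E:F^*\to\mathrm{Aut}_F(L_F(E))$, $t\mapsto\tau^E_t$, is the gauge action. Let $A$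 be an associative (not necessarily unital) $F$-algebra and let $\phi:L_F(E)\to A$ be an $F$-algebra homomorphism such that $\phi(p_v)\neq 0$ for every $v\in E^0$. If there exists a group action $\sigma:F^*\to\mathrm{Aut}_F(A)$ by $F$-algebra automorphisms such that $\phi\circ\tau^E_t=\sigma_t\circ\phi$ for every $t\in F^*$, then $\phi$ is injective. -/

import Mathlib

universe u v w z

noncomputable section

/-- The automorphism group `Aut_F(A)` of a (not necessarily unital) `F`-algebra `A`: the group,
under composition, of the bijective `F`-linear maps `A → A` which preserve multiplication. -/
def algebraAut (F : Type u) (A : Type v) [Field F] [NonUnitalRing A] [Module F A] :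
    Subgroup (A ≃ₗ[F] A) where
  carrier := {f | ∀ a b : A, f (a * b) = f a * f b}
  one_mem' := fun _ _ => rfl
  mul_mem' := by
    intro f g hf hg a b
    change f (g (a * b)) = f (g a) * f (g b)
    rw [hg, hf]
  inv_mem' := by
    intro f hf a b
    change f.symm (a * b) = f.symm a * f.symm b
    apply f.injective
    rw [hf]
    simp

namespace LeavittPathAlgebra

/-- The generators of the Leavitt path algebra of a directed graph. A directed graph (possibly with
loops, parallel edges and infinitely many vertices and edges) is a quiver `V`: its vertices are
the elements of `E⁰ = V`, its edges the elements of `E¹ = Quiver.Total V`; the edge `e` has source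
`s(e) = e.left` and range `r(e) = e.right`. -/
inductive Generator (V : Type u) [Quiver.{v} V] : Type (max u v)
  | p (a : V) : Generator V
  | x (e : Quiver.Total V) : Generator V
  | y (e : Quiver.Total V) : Generator V

/-- The free associative non-unital `F`-algebra on the generators: its basis consists of the
non-empty words in the generators. -/
abbrev FreeAlg (F : Type w) (V : Type u) [Field F] [Quiver.{v} V] : Type (max u v w) :=
  MonoidAlgebra F (FreeSemigroup (Generator V))

section Relations

variable (F : Type w) (V : Type u) [Field F] [Quiver.{v} V]

/-- A generator as an element of the free algebra. -/
def gen (g : Generator V) : FreeAlg F V := MonoidAlgebra.single (FreeSemigroup.of g) 1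

/-- The defining relations of the Leavitt path algebra (the first nine constructors),
closed under the algebra operations (the last four constructors). -/
inductive Rel : FreeAlg F V → FreeAlg F V → Prop
  | p_mul_self (a : V) : Rel (gen F V (.p a) * gen F V (.p a)) (gen F V (.p a))
  | p_mul_of_ne (a b : V) (h : a ≠ b) : Rel (gen F V (.p a) * gen F V (.p b)) 0
  | source_mul_x (e : Quiver.Total V) :
      Rel (gen F V (.p e.left) * gen F V (.x e)) (gen F V (.x e))
  | x_mul_range (e : Quiver.Total V) :
      Rel (gen F V (.x e) * gen F V (.p e.right)) (gen F V (.x e))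
  | range_mul_y (e : Quiver.Total V) :
      Rel (gen F V (.p e.right) * gen F V (.y e)) (gen F V (.y e))
  | y_mul_source (e : Quiver.Total V) :
      Rel (gen F V (.y e) * gen F V (.p e.left)) (gen F V (.y e))
  | y_mul_x_self (e : Quiver.Total V) :
      Rel (gen F V (.y e) * gen F V (.x e)) (gen F V (.p e.right))
  | y_mul_x_of_ne (e f : Quiver.Total V) (h : e ≠ f) :
      Rel (gen F V (.y e) * gen F V (.x f)) 0
  | vertex_eq_sum (a : V) (hfin : {e : Quiver.Total V | e.left = a}.Finite)
      (hne : {e : Quiver.Total V | e.left = a}.Nonempty) :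
      Rel (gen F V (.p a)) (∑ e ∈ hfin.toFinset, gen F V (.x e) * gen F V (.y e))
  | smul (t : F) {a b : FreeAlg F V} : Rel a b → Rel (t • a) (t • b)
  | add_right {a b : FreeAlg F V} (c : FreeAlg F V) : Rel a b → Rel (a + c) (b + c)
  | mul_left (a : FreeAlg F V) {b c : FreeAlg F V} : Rel b c → Rel (a * b) (a * c)
  | mul_right {a b : FreeAlg F V} (c : FreeAlg F V) : Rel a b → Rel (a * c) (b * c)

variable {F V}

theorem Rel.add_left (a : FreeAlg F V) {b c : FreeAlg F V} (h : Rel F V b c) :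
    Rel F V (a + b) (a + c) := by
  rw [add_comm _ b, add_comm _ c]
  exact h.add_right _

theorem Rel.neg {a b : FreeAlg F V} (h : Rel F V a b) : Rel F V (-a) (-b) := by
  simpa only [neg_one_smul] using h.smul (-1)

end Relations

end LeavittPathAlgebra

/-- The Leavitt path algebra `L_F(E)`: the (in general non-unital) associative `F`-algebra
presented by the generators `p_v`, `x_e`, `y_e` and the defining relations, that is, the quotient
of the free algebra by the equivalence relation generated by `Rel`. -/
def LeavittPathAlgebra (F : Type w) (V : Type u) [Field F] [Quiver.{v} V] : Type (max u v w) :=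
  Quot (LeavittPathAlgebra.Rel F V)

namespace LeavittPathAlgebra

section Algebra

variable (F : Type w) (V : Type u) [Field F] [Quiver.{v} V]

instance : Zero (LeavittPathAlgebra F V) where
  zero := Quot.mk _ 0

instance : Add (LeavittPathAlgebra F V) where
  add := Quot.map₂ (· + ·) (fun _ _ _ => Rel.add_left _) fun _ _ _ => Rel.add_right _

instance : Neg (LeavittPathAlgebra F V) where
  neg := Quot.map Neg.neg fun _ _ => Rel.neg

instance : Mul (LeavittPathAlgebra F V) where
  mul := Quot.map₂ (· * ·) (fun _ _ _ => Rel.mul_left _) fun _ _ _ => Rel.mul_right _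

instance : SMul F (LeavittPathAlgebra F V) where
  smul t := Quot.map (t • ·) fun _ _ => Rel.smul t

instance : NonUnitalRing (LeavittPathAlgebra F V) where
  add_assoc := by rintro ⟨a⟩ ⟨b⟩ ⟨c⟩; exact congrArg (Quot.mk _) (add_assoc a b c)
  zero_add := by rintro ⟨a⟩; exact congrArg (Quot.mk _) (zero_add a)
  add_zero := by rintro ⟨a⟩; exact congrArg (Quot.mk _) (add_zero a)
  add_comm := by rintro ⟨a⟩ ⟨b⟩; exact congrArg (Quot.mk _) (add_comm a b)
  neg_add_cancel := by rintro ⟨a⟩; exact congrArg (Quot.mk _) (neg_add_cancel a)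
  left_distrib := by rintro ⟨a⟩ ⟨b⟩ ⟨c⟩; exact congrArg (Quot.mk _) (mul_add a b c)
  right_distrib := by rintro ⟨a⟩ ⟨b⟩ ⟨c⟩; exact congrArg (Quot.mk _) (add_mul a b c)
  zero_mul := by rintro ⟨a⟩; exact congrArg (Quot.mk _) (zero_mul a)
  mul_zero := by rintro ⟨a⟩; exact congrArg (Quot.mk _) (mul_zero a)
  mul_assoc := by rintro ⟨a⟩ ⟨b⟩ ⟨c⟩; exact congrArg (Quot.mk _) (mul_assoc a b c)
  nsmul := nsmulRec
  zsmul := zsmulRec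

instance : Module F (LeavittPathAlgebra F V) where
  one_smul := by rintro ⟨a⟩; exact congrArg (Quot.mk _) (one_smul F a)
  mul_smul := by rintro s t ⟨a⟩; exact congrArg (Quot.mk _) (mul_smul s t a)
  smul_zero := by intro t; exact congrArg (Quot.mk _) (smul_zero t)
  smul_add := by rintro t ⟨a⟩ ⟨b⟩; exact congrArg (Quot.mk _) (smul_add t a b)
  add_smul := by rintro s t ⟨a⟩; exact congrArg (Quot.mk _) (add_smul s t a)
  zero_smul := by rintro ⟨a⟩; exact congrArg (Quot.mk _) (zero_smul F a)

instance : IsScalarTower F (LeavittPathAlgebra F V) (LeavittPathAlgebra F V) where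
  smul_assoc := by rintro t ⟨a⟩ ⟨b⟩; exact congrArg (Quot.mk _) (smul_mul_assoc t a b)

instance : SMulCommClass F (LeavittPathAlgebra F V) (LeavittPathAlgebra F V) where
  smul_comm := by rintro t ⟨a⟩ ⟨b⟩; exact congrArg (Quot.mk _) (mul_smul_comm t a b).symm

/-- The quotient map from the free algebra. -/
def mk : FreeAlg F V →ₙₐ[F] LeavittPathAlgebra F V where
  toFun := Quot.mk (Rel F V)
  map_smul' _ _ := rfl
  map_zero' := rfl
  map_add' _ _ := rfl
  map_mul' _ _ := rfl

/-- The idempotent `p_v` of the vertex `v`. -/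
def p (a : V) : LeavittPathAlgebra F V := mk F V (gen F V (.p a))

/-- The element `x_e` of the edge `e`. -/
def x (e : Quiver.Total V) : LeavittPathAlgebra F V := mk F V (gen F V (.x e))

/-- The element `y_e` of the edge `e` (the ghost edge). -/
def y (e : Quiver.Total V) : LeavittPathAlgebra F V := mk F V (gen F V (.y e))

end Algebra

/-- The families `(P, X, Y)` in an `F`-algebra which satisfy the defining relations of the
Leavitt path algebra of the directed graph `V`. -/
structure IsFamily {V : Type u} [Quiver.{v} V] {B : Type z} [NonUnitalRing B]
    (P : V → B) (X Y : Quiver.Total V → B) : Prop where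
  p_mul_self : ∀ a, P a * P a = P a
  p_mul_of_ne : ∀ a b, a ≠ b → P a * P b = 0
  source_mul_x : ∀ e, P e.left * X e = X e
  x_mul_range : ∀ e, X e * P e.right = X e
  range_mul_y : ∀ e, P e.right * Y e = Y e
  y_mul_source : ∀ e, Y e * P e.left = Y e
  y_mul_x_self : ∀ e, Y e * X e = P e.right
  y_mul_x_of_ne : ∀ e f, e ≠ f → Y e * X f = 0
  vertex_eq_sum : ∀ (a : V) (hfin : {e : Quiver.Total V | e.left = a}.Finite),
    {e : Quiver.Total V | e.left = a}.Nonempty → P a = ∑ e ∈ hfin.toFinset, X e * Y e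

section Universal

variable {F : Type w} {V : Type u} [Field F] [Quiver.{v} V]

theorem isFamily : IsFamily (p F V) (x F V) (y F V) where
  p_mul_self a := Quot.sound (Rel.p_mul_self a)
  p_mul_of_ne a b h := Quot.sound (Rel.p_mul_of_ne a b h)
  source_mul_x e := Quot.sound (Rel.source_mul_x e)
  x_mul_range e := Quot.sound (Rel.x_mul_range e)
  range_mul_y e := Quot.sound (Rel.range_mul_y e)
  y_mul_source e := Quot.sound (Rel.y_mul_source e)
  y_mul_x_self e := Quot.sound (Rel.y_mul_x_self e)
  y_mul_x_of_ne e f h := Quot.sound (Rel.y_mul_x_of_ne e f h)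
  vertex_eq_sum a hfin hne := by
    have h : mk F V (gen F V (.p a)) =
        mk F V (∑ e ∈ hfin.toFinset, gen F V (.x e) * gen F V (.y e)) :=
      Quot.sound (Rel.vertex_eq_sum a hfin hne)
    rw [map_sum] at h
    simp only [map_mul] at h
    exact h

variable {B : Type z} [NonUnitalRing B] [Module F B] [IsScalarTower F B B] [SMulCommClass F B B]

/-- The homomorphism from the free algebra with prescribed values on the generators. -/
def freeLift (P : V → B) (X Y : Quiver.Total V → B) : FreeAlg F V →ₙₐ[F] B :=
  MonoidAlgebra.liftMagma F (FreeSemigroup.lift fun g : Generator V =>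
    match g with
    | .p a => P a
    | .x e => X e
    | .y e => Y e)

@[simp]
theorem freeLift_p (P : V → B) (X Y : Quiver.Total V → B) (a : V) :
    freeLift P X Y (gen F V (.p a)) = P a := by
  simp [freeLift, gen]

@[simp]
theorem freeLift_x (P : V → B) (X Y : Quiver.Total V → B) (e : Quiver.Total V) :
    freeLift P X Y (gen F V (.x e)) = X e := by
  simp [freeLift, gen]

@[simp]
theorem freeLift_y (P : V → B) (X Y : Quiver.Total V → B) (e : Quiver.Total V) :
    freeLift P X Y (gen F V (.y e)) = Y e := by
  simp [freeLift, gen]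

theorem freeLift_rel {P : V → B} {X Y : Quiver.Total V → B} (h : IsFamily P X Y)
    {a b : FreeAlg F V} (hab : Rel F V a b) : freeLift P X Y a = freeLift P X Y b := by
  induction hab with
  | p_mul_self a => simpa using h.p_mul_self a
  | p_mul_of_ne a b hne => simpa using h.p_mul_of_ne a b hne
  | source_mul_x e => simpa using h.source_mul_x e
  | x_mul_range e => simpa using h.x_mul_range e
  | range_mul_y e => simpa using h.range_mul_y e
  | y_mul_source e => simpa using h.y_mul_source e
  | y_mul_x_self e => simpa using h.y_mul_x_self e
  | y_mul_x_of_ne e f hne => simpa using h.y_mul_x_of_ne e f hne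
  | vertex_eq_sum a hfin hne => simpa [map_sum] using h.vertex_eq_sum a hfin hne
  | smul t _ ih => simp only [map_smul, ih]
  | add_right c _ ih => simp only [map_add, ih]
  | mul_left a _ ih => simp only [map_mul, ih]
  | mul_right c _ ih => simp only [map_mul, ih]

/-- The universal property: a family satisfying the defining relations in an `F`-algebra `B`
extends to a homomorphism of `F`-algebras from the Leavitt path algebra to `B`. -/
def lift {P : V → B} {X Y : Quiver.Total V → B} (h : IsFamily P X Y) :
    LeavittPathAlgebra F V →ₙₐ[F] B where
  toFun := Quot.lift (freeLift P X Y) fun _ _ => freeLift_rel h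
  map_smul' := by rintro t ⟨a⟩; exact map_smul (freeLift P X Y) t a
  map_zero' := map_zero (freeLift P X Y)
  map_add' := by rintro ⟨a⟩ ⟨b⟩; exact map_add (freeLift P X Y) a b
  map_mul' := by rintro ⟨a⟩ ⟨b⟩; exact map_mul (freeLift P X Y) a b

@[simp]
theorem lift_p {P : V → B} {X Y : Quiver.Total V → B} (h : IsFamily P X Y) (a : V) :
    lift h (p F V a) = P a :=
  freeLift_p P X Y a

@[simp]
theorem lift_x {P : V → B} {X Y : Quiver.Total V → B} (h : IsFamily P X Y)
    (e : Quiver.Total V) : lift h (x F V e) = X e :=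
  freeLift_x P X Y e

@[simp]
theorem lift_y {P : V → B} {X Y : Quiver.Total V → B} (h : IsFamily P X Y)
    (e : Quiver.Total V) : lift h (y F V e) = Y e :=
  freeLift_y P X Y e

theorem hom_ext {C : Type z} [NonUnitalRing C] [Module F C]
    {f g : LeavittPathAlgebra F V →ₙₐ[F] C} (hp : ∀ a, f (p F V a) = g (p F V a))
    (hx : ∀ e, f (x F V e) = g (x F V e)) (hy : ∀ e, f (y F V e) = g (y F V e)) : f = g := by
  have key : f.comp (mk F V) = g.comp (mk F V) := by
    apply MonoidAlgebra.nonUnitalAlgHom_ext'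
    apply FreeSemigroup.hom_ext
    funext i
    cases i with
    | p a => exact hp a
    | x e => exact hx e
    | y e => exact hy e
  ext ⟨a⟩
  exact DFunLike.congr_fun key a

end Universal

section Gauge

variable (F : Type w) (V : Type u) [Field F] [Quiver.{v} V]

theorem isFamily_gauge (t : Fˣ) :
    IsFamily (p F V) (fun e => t⁻¹ • x F V e) (fun e => t • y F V e) where
  p_mul_self := isFamily.p_mul_self
  p_mul_of_ne := isFamily.p_mul_of_ne
  source_mul_x e := by rw [Units.smul_def, mul_smul_comm, isFamily.source_mul_x]
  x_mul_range e := by rw [Units.smul_def, smul_mul_assoc, isFamily.x_mul_range]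
  range_mul_y e := by rw [Units.smul_def, mul_smul_comm, isFamily.range_mul_y]
  y_mul_source e := by rw [Units.smul_def, smul_mul_assoc, isFamily.y_mul_source]
  y_mul_x_self e := by
    rw [Units.smul_def, Units.smul_def, smul_mul_assoc, mul_smul_comm, isFamily.y_mul_x_self,
      smul_smul, Units.mul_inv, one_smul]
  y_mul_x_of_ne e f h := by
    rw [Units.smul_def, Units.smul_def, smul_mul_assoc, mul_smul_comm,
      isFamily.y_mul_x_of_ne e f h, smul_zero, smul_zero]
  vertex_eq_sum a hfin hne := by
    rw [isFamily.vertex_eq_sum a hfin hne]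
    refine Finset.sum_congr rfl fun e _ => ?_
    rw [Units.smul_def, Units.smul_def, smul_mul_assoc, mul_smul_comm, smul_smul, Units.inv_mul,
      one_smul]

/-- The endomorphism of the Leavitt path algebra with `p_v ↦ p_v`, `x_e ↦ t⁻¹ x_e` and
`y_e ↦ t y_e`. -/
def gaugeHom (t : Fˣ) : LeavittPathAlgebra F V →ₙₐ[F] LeavittPathAlgebra F V :=
  lift (isFamily_gauge F V t)

theorem gaugeHom_one : gaugeHom F V 1 = NonUnitalAlgHom.id F (LeavittPathAlgebra F V) := by
  apply hom_ext <;> intro i <;> simp [gaugeHom]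

theorem gaugeHom_mul (s t : Fˣ) :
    gaugeHom F V (s * t) = (gaugeHom F V s).comp (gaugeHom F V t) := by
  apply hom_ext <;> intro i <;>
    simp [gaugeHom, Units.smul_def, smul_smul, mul_comm]

theorem gaugeHom_gaugeHom_inv (t : Fˣ) (a : LeavittPathAlgebra F V) :
    gaugeHom F V t (gaugeHom F V t⁻¹ a) = a := by
  have h := gaugeHom_mul F V t t⁻¹
  rw [mul_inv_cancel, gaugeHom_one] at h
  exact (DFunLike.congr_fun h a).symm

/-- The gauge action `τ : F^* → Aut_F(L_F(E))`, where `τ_t` is the automorphism with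
`p_v ↦ p_v`, `x_e ↦ t⁻¹ x_e` and `y_e ↦ t y_e`. -/
def gaugeAction : Fˣ →* algebraAut F (LeavittPathAlgebra F V) where
  toFun t :=
    ⟨{ toFun := gaugeHom F V t
       invFun := gaugeHom F V t⁻¹
       map_add' := map_add (gaugeHom F V t)
       map_smul' := map_smul (gaugeHom F V t)
       left_inv := fun a => by
         have h := gaugeHom_gaugeHom_inv F V t⁻¹ a
         rwa [inv_inv] at h
       right_inv := gaugeHom_gaugeHom_inv F V t },
      map_mul (gaugeHom F V t)⟩
  map_one' := by
    apply Subtype.ext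
    ext a
    exact DFunLike.congr_fun (gaugeHom_one F V) a
  map_mul' s t := by
    apply Subtype.ext
    ext a
    exact DFunLike.congr_fun (gaugeHom_mul F V s t) a

end Gauge

end LeavittPathAlgebra

end

/-! The monomials `x…x p y…y` span the algebra, and the gauge action scales a monomial of degree n
(number of x's minus number of y's) by t⁻ⁿ. Hence φ sends the homogeneous parts of an element to
eigenvectors of σ_t. As F is infinite, some t makes the finitely many eigenvalues involved distinct,
so if the element lies in the kernel then so does each of its parts
(`eq_zero_of_sum_eigenvectors_eq_zero`, `exists_unit_zpow_injOn`).

It remains to see that a homogeneous a with φ a = 0 vanishes (`eq_zero_of_mem_bounded`). In positive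
degree every monomial starts with an x, so a is recovered from the shorter elements y_e a; negative
degree is symmetric, with a x_f. In degree zero, a is a combination of vertices plus terms x_e b
y_f, and such terms are recovered from the y_e a x_f. The vertex part is handled by
`mem_innerSpan_of_map_eq_zero`: relation (4) absorbs the regular vertices, while sinks and infinite
emitters have zero coefficient because φ(p_v) ≠ 0. Since the kernel is an ideal, the shorter
elements stay in it and the descent ends at combinations of vertices. -/

namespace LeavittPathAlgebra

/-! ### Spanning by monomials -/

section Monomials

variable {F : Type w} {V : Type u} [Field F] [Quiver.{v} V]

/-- A subalgebra which contains the generators is everything. -/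
theorem mem_of_gen_mem (S : NonUnitalSubalgebra F (LeavittPathAlgebra F V))
    (hp : ∀ a, p F V a ∈ S) (hx : ∀ e, x F V e ∈ S) (hy : ∀ e, y F V e ∈ S)
    (a : LeavittPathAlgebra F V) : a ∈ S := by
  have hgen : ∀ g : Generator V, mk F V (gen F V g) ∈ S := by
    rintro (a | e | e)
    exacts [hp a, hx e, hy e]
  have hword : ∀ w : FreeSemigroup (Generator V), mk F V (MonoidAlgebra.single w 1) ∈ S := by
    intro w
    induction w using FreeSemigroup.recOnMul with
    | ih1 g => exact hgen g
    | ih2 g w hg hw =>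
      have h : (MonoidAlgebra.single (FreeSemigroup.of g * w) 1 : FreeAlg F V) =
          MonoidAlgebra.single (FreeSemigroup.of g) 1 * MonoidAlgebra.single w 1 := by
        rw [MonoidAlgebra.single_mul_single, one_mul]
      rw [h, map_mul]
      exact S.mul_mem hg hw
  obtain ⟨b, rfl⟩ : ∃ b, mk F V b = a := Quot.exists_rep a
  induction b using MonoidAlgebra.induction_linear with
  | zero => rw [map_zero]; exact S.zero_mem
  | add f g hf hg => rw [map_add]; exact S.add_mem hf hg
  | single w c =>
    have h : (MonoidAlgebra.single w c : FreeAlg F V) = c • MonoidAlgebra.single w 1 := by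
      rw [MonoidAlgebra.smul_single, smul_eq_mul, mul_one]
    rw [h, map_smul]
    exact S.toSubmodule.smul_mem c (hword w)

theorem p_mul_x_of_ne {a : V} {e : Quiver.Total V} (h : a ≠ e.left) :
    p F V a * x F V e = 0 := by
  rw [← isFamily.source_mul_x, ← mul_assoc, isFamily.p_mul_of_ne _ _ h, zero_mul]

theorem y_mul_p_of_ne {a : V} {e : Quiver.Total V} (h : e.left ≠ a) :
    y F V e * p F V a = 0 := by
  rw [← isFamily.y_mul_source, mul_assoc, isFamily.p_mul_of_ne _ _ h, mul_zero]

variable (F) in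
/-- The monomial `x_{e₁} ⋯ x_{eₘ} p_v y_{fₖ} ⋯ y_{f₁}`. -/
noncomputable def mon : List (Quiver.Total V) → V → List (Quiver.Total V) → LeavittPathAlgebra F V
  | [], a, [] => p F V a
  | [], a, f :: ys => mon [] a ys * y F V f
  | e :: xs, a, ys => x F V e * mon xs a ys

theorem mon_nil_nil (a : V) : mon F [] a [] = p F V a := by rw [mon]

theorem mon_cons_left (e : Quiver.Total V) (xs : List (Quiver.Total V)) (a : V)
    (ys : List (Quiver.Total V)) : mon F (e :: xs) a ys = x F V e * mon F xs a ys := by rw [mon]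

theorem mon_cons_right (xs : List (Quiver.Total V)) (a : V) (f : Quiver.Total V)
    (ys : List (Quiver.Total V)) : mon F xs a (f :: ys) = mon F xs a ys * y F V f := by
  induction xs with
  | nil => rw [mon]
  | cons e xs ih => rw [mon_cons_left, mon_cons_left, ih, mul_assoc]

/-- Only the leftmost letter matters. Words in `mon` need not be composable, so this dichotomy takes
the place of any bookkeeping of path endpoints. -/
theorem p_mul_mon (b : V) (xs : List (Quiver.Total V)) (a : V) (ys : List (Quiver.Total V)) :
    p F V b * mon F xs a ys = mon F xs a ys ∨ p F V b * mon F xs a ys = 0 := by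
  cases xs with
  | cons e xs =>
    rw [mon_cons_left, ← mul_assoc]
    by_cases h : b = e.left
    · left; rw [h, isFamily.source_mul_x]
    · right; rw [p_mul_x_of_ne h, zero_mul]
  | nil =>
    induction ys with
    | nil =>
      rw [mon_nil_nil]
      by_cases h : b = a
      · left; rw [h, isFamily.p_mul_self]
      · right; exact isFamily.p_mul_of_ne _ _ h
    | cons f ys ih =>
      rw [mon_cons_right, ← mul_assoc]
      rcases ih with ih | ih
      · left; rw [ih]
      · right; rw [ih, zero_mul]

theorem mon_mul_p (b : V) (xs : List (Quiver.Total V)) (a : V) (ys : List (Quiver.Total V)) :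
    mon F xs a ys * p F V b = mon F xs a ys ∨ mon F xs a ys * p F V b = 0 := by
  cases ys with
  | cons f ys =>
    rw [mon_cons_right, mul_assoc]
    by_cases h : f.left = b
    · left; rw [← h, isFamily.y_mul_source]
    · right; rw [y_mul_p_of_ne h, mul_zero]
  | nil =>
    induction xs with
    | nil =>
      rw [mon_nil_nil]
      by_cases h : a = b
      · left; rw [h, isFamily.p_mul_self]
      · right; exact isFamily.p_mul_of_ne _ _ h
    | cons e xs ih =>
      rw [mon_cons_left, mul_assoc]
      rcases ih with ih | ih
      · left; rw [ih]
      · right; rw [ih, mul_zero]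

/-- Cancellation y_e x_f = δ p_{r(e)} removes exactly one x and leaves the y's alone; the descent
relies on this exact form. -/
theorem y_mul_mon_cons (e f : Quiver.Total V) (xs : List (Quiver.Total V)) (a : V)
    (ys : List (Quiver.Total V)) :
    y F V e * mon F (f :: xs) a ys = mon F xs a ys ∨ y F V e * mon F (f :: xs) a ys = 0 := by
  rw [mon_cons_left, ← mul_assoc]
  by_cases h : e = f
  · rw [h, isFamily.y_mul_x_self]
    exact p_mul_mon _ _ _ _
  · right; rw [isFamily.y_mul_x_of_ne _ _ h, zero_mul]

theorem mon_cons_mul_x (e f : Quiver.Total V) (xs : List (Quiver.Total V)) (a : V)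
    (ys : List (Quiver.Total V)) :
    mon F xs a (f :: ys) * x F V e = mon F xs a ys ∨ mon F xs a (f :: ys) * x F V e = 0 := by
  rw [mon_cons_right, mul_assoc]
  by_cases h : f = e
  · rw [h, isFamily.y_mul_x_self]
    exact mon_mul_p _ _ _ _
  · right; rw [isFamily.y_mul_x_of_ne _ _ h, mul_zero]

theorem y_eq_mon (e : Quiver.Total V) : y F V e = mon F [] e.right [e] := by
  rw [mon_cons_right, mon_nil_nil, isFamily.range_mul_y]

theorem x_eq_mon (e : Quiver.Total V) : x F V e = mon F [e] e.right [] := by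
  rw [mon_cons_left, mon_nil_nil, isFamily.x_mul_range]

/-- With no x to cancel, y_e meets the vertex and is either absorbed as a new innermost y or killed.
-/
theorem y_mul_mon (e : Quiver.Total V) (xs : List (Quiver.Total V)) (a : V)
    (ys : List (Quiver.Total V)) :
    (∃ xs' a' ys', y F V e * mon F xs a ys = mon F xs' a' ys') ∨
      y F V e * mon F xs a ys = 0 := by
  cases xs with
  | cons f xs => exact (y_mul_mon_cons e f xs a ys).imp_left fun h => ⟨_, _, _, h⟩
  | nil =>
    induction ys with
    | nil =>
      rw [mon_nil_nil]
      by_cases h : e.left = a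
      · left; rw [← h, isFamily.y_mul_source]; exact ⟨_, _, _, y_eq_mon e⟩
      · right; exact y_mul_p_of_ne h
    | cons f ys ih =>
      rw [mon_cons_right, ← mul_assoc]
      rcases ih with ⟨xs', a', ys', h⟩ | h
      · left; rw [h]; exact ⟨_, _, _, (mon_cons_right _ _ _ _).symm⟩
      · right; rw [h, zero_mul]

variable (F V) in
/-- The span of all monomials. -/
noncomputable def monSpan : Submodule F (LeavittPathAlgebra F V) :=
  Submodule.span F {b | ∃ xs a ys, mon F xs a ys = b}

theorem mon_mem_monSpan (xs : List (Quiver.Total V)) (a : V) (ys : List (Quiver.Total V)) :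
    mon F xs a ys ∈ monSpan F V :=
  Submodule.subset_span ⟨xs, a, ys, rfl⟩

theorem mul_mem_of_mon {g : LeavittPathAlgebra F V} {s : Set (LeavittPathAlgebra F V)}
    {M : Submodule F (LeavittPathAlgebra F V)} (h : ∀ b ∈ s, g * b ∈ M)
    {m : LeavittPathAlgebra F V} (hm : m ∈ Submodule.span F s) : g * m ∈ M := by
  have : Submodule.span F s ≤ M.comap (LinearMap.mulLeft F g) := Submodule.span_le.2 h
  exact this hm

theorem mul_mem_of_mon' {g : LeavittPathAlgebra F V} {s : Set (LeavittPathAlgebra F V)}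
    {M : Submodule F (LeavittPathAlgebra F V)} (h : ∀ b ∈ s, b * g ∈ M)
    {m : LeavittPathAlgebra F V} (hm : m ∈ Submodule.span F s) : m * g ∈ M := by
  have : Submodule.span F s ≤ M.comap (LinearMap.mulRight F g) := Submodule.span_le.2 h
  exact this hm

theorem mem_monSpan (a : LeavittPathAlgebra F V) : a ∈ monSpan F V := by
  -- Elements of the span whose left multiplication preserves the span form a subalgebra, so it is
  -- enough to multiply monomials on the left by generators.
  let S : NonUnitalSubalgebra F (LeavittPathAlgebra F V) :=
    { carrier := {a | a ∈ monSpan F V ∧ ∀ m ∈ monSpan F V, a * m ∈ monSpan F V}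
      zero_mem' := ⟨zero_mem _, fun m _ => by rw [zero_mul]; exact zero_mem _⟩
      add_mem' := fun ha hb => ⟨add_mem ha.1 hb.1, fun m hm => by
        rw [add_mul]; exact add_mem (ha.2 m hm) (hb.2 m hm)⟩
      mul_mem' := fun ha hb => ⟨ha.2 _ hb.1, fun m hm => by
        rw [mul_assoc]; exact ha.2 _ (hb.2 m hm)⟩
      smul_mem' := fun c a ha => ⟨Submodule.smul_mem _ c ha.1, fun m hm => by
        rw [smul_mul_assoc]; exact Submodule.smul_mem _ c (ha.2 m hm)⟩ }
  suffices h : a ∈ S from h.1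
  refine mem_of_gen_mem S ?_ ?_ ?_ a
  · refine fun b => ⟨mon_nil_nil (F := F) b ▸ mon_mem_monSpan _ _ _,
      fun m hm => mul_mem_of_mon ?_ hm⟩
    rintro _ ⟨xs, c, ys, rfl⟩
    rcases p_mul_mon (F := F) b xs c ys with h | h <;> rw [h]
    exacts [mon_mem_monSpan _ _ _, zero_mem _]
  · refine fun e => ⟨x_eq_mon (F := F) e ▸ mon_mem_monSpan _ _ _,
      fun m hm => mul_mem_of_mon ?_ hm⟩
    rintro _ ⟨xs, c, ys, rfl⟩
    rw [← mon_cons_left]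
    exact mon_mem_monSpan _ _ _
  · refine fun e => ⟨y_eq_mon (F := F) e ▸ mon_mem_monSpan _ _ _,
      fun m hm => mul_mem_of_mon ?_ hm⟩
    rintro _ ⟨xs, c, ys, rfl⟩
    rcases y_mul_mon (F := F) e xs c ys with ⟨_, _, _, h⟩ | h <;> rw [h]
    exacts [mon_mem_monSpan _ _ _, zero_mem _]

end Monomials

/-! ### Local units and cancellation of outer letters -/

section LocalUnits

variable {F : Type w} {V : Type u} [Field F] [Quiver.{v} V]

/-- On the span of the elements `x_e b`, the finite sums `∑ x_e y_e` are local left units. -/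
theorem exists_sum_mul_eq {a : LeavittPathAlgebra F V}
    (ha : a ∈ Submodule.span F {c | ∃ e b, x F V e * b = c}) :
    ∃ S : Finset (Quiver.Total V), ∀ T, S ⊆ T → ∑ e ∈ T, x F V e * (y F V e * a) = a := by
  classical
  induction ha using Submodule.span_induction with
  | zero => exact ⟨∅, fun T _ => by simp⟩
  | add a b _ _ iha ihb =>
    obtain ⟨S, hS⟩ := iha
    obtain ⟨S', hS'⟩ := ihb
    -- Validity for every T ⊇ S, not just for S, is what lets two summands share one finite set.
    refine ⟨S ∪ S', fun T hT => ?_⟩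
    simp only [mul_add, Finset.sum_add_distrib]
    rw [hS T (Finset.union_subset_left hT), hS' T (Finset.union_subset_right hT)]
  | smul t a _ ih =>
    obtain ⟨S, hS⟩ := ih
    refine ⟨S, fun T hT => ?_⟩
    simp only [mul_smul_comm, ← Finset.smul_sum]
    rw [hS T hT]
  | mem c hc =>
    obtain ⟨f, b, rfl⟩ := hc
    refine ⟨{f}, fun T hT => ?_⟩
    rw [Finset.sum_eq_single_of_mem f (hT (Finset.mem_singleton_self f))]
    · rw [← mul_assoc (y F V f), isFamily.y_mul_x_self, ← mul_assoc, isFamily.x_mul_range]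
    · intro e _ he
      rw [← mul_assoc (y F V e), isFamily.y_mul_x_of_ne _ _ he, zero_mul, mul_zero]

/-- On the span of the elements `b y_f`, the finite sums `∑ x_f y_f` are local right units. -/
theorem exists_mul_sum_eq {a : LeavittPathAlgebra F V}
    (ha : a ∈ Submodule.span F {c | ∃ b f, b * y F V f = c}) :
    ∃ S : Finset (Quiver.Total V), ∀ T, S ⊆ T → ∑ e ∈ T, a * x F V e * y F V e = a := by
  classical
  induction ha using Submodule.span_induction with
  | zero => exact ⟨∅, fun T _ => by simp⟩
  | add a b _ _ iha ihb =>
    obtain ⟨S, hS⟩ := iha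
    obtain ⟨S', hS'⟩ := ihb
    refine ⟨S ∪ S', fun T hT => ?_⟩
    simp only [add_mul, Finset.sum_add_distrib]
    rw [hS T (Finset.union_subset_left hT), hS' T (Finset.union_subset_right hT)]
  | smul t a _ ih =>
    obtain ⟨S, hS⟩ := ih
    refine ⟨S, fun T hT => ?_⟩
    simp only [smul_mul_assoc, ← Finset.smul_sum]
    rw [hS T hT]
  | mem c hc =>
    obtain ⟨b, f, rfl⟩ := hc
    refine ⟨{f}, fun T hT => ?_⟩
    rw [Finset.sum_eq_single_of_mem f (hT (Finset.mem_singleton_self f))]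
    · rw [mul_assoc b, isFamily.y_mul_x_self, mul_assoc, isFamily.range_mul_y]
    · intro e _ he
      rw [mul_assoc b, isFamily.y_mul_x_of_ne _ _ he.symm, mul_zero, zero_mul]

/-- A local unit rebuilds a as a finite sum of x_e (y_e a). -/
theorem eq_zero_of_y_mul {a : LeavittPathAlgebra F V}
    (ha : a ∈ Submodule.span F {c | ∃ e b, x F V e * b = c})
    (h : ∀ e, y F V e * a = 0) : a = 0 := by
  obtain ⟨S, hS⟩ := exists_sum_mul_eq ha
  rw [← hS S subset_rfl]
  exact Finset.sum_eq_zero fun e _ => by rw [h, mul_zero]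

theorem eq_zero_of_mul_x {a : LeavittPathAlgebra F V}
    (ha : a ∈ Submodule.span F {c | ∃ b f, b * y F V f = c})
    (h : ∀ e, a * x F V e = 0) : a = 0 := by
  obtain ⟨S, hS⟩ := exists_mul_sum_eq ha
  rw [← hS S subset_rfl]
  exact Finset.sum_eq_zero fun e _ => by rw [h, zero_mul]

/-- The span of the elements `b y_f` is a left ideal. -/
theorem mul_mem_span_mul_y (g : LeavittPathAlgebra F V) {a : LeavittPathAlgebra F V}
    (ha : a ∈ Submodule.span F {c | ∃ b f, b * y F V f = c}) :
    g * a ∈ Submodule.span F {c | ∃ b f, b * y F V f = c} := by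
  refine mul_mem_of_mon ?_ ha
  rintro _ ⟨b, f, rfl⟩
  exact Submodule.subset_span ⟨g * b, f, mul_assoc _ _ _⟩

variable (F V) in
/-- The span of the elements `x_e b y_f`. -/
noncomputable def innerSpan : Submodule F (LeavittPathAlgebra F V) :=
  Submodule.span F {c | ∃ e b f, x F V e * b * y F V f = c}

theorem innerSpan_le_left :
    innerSpan F V ≤ Submodule.span F {c | ∃ e b, x F V e * b = c} := by
  refine Submodule.span_mono ?_
  rintro _ ⟨e, b, f, rfl⟩
  exact ⟨e, b * y F V f, (mul_assoc _ _ _).symm⟩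

theorem innerSpan_le_right :
    innerSpan F V ≤ Submodule.span F {c | ∃ b f, b * y F V f = c} := by
  refine Submodule.span_mono ?_
  rintro _ ⟨e, b, f, rfl⟩
  exact ⟨x F V e * b, f, rfl⟩

/-- Left multiplication by y_e keeps a in the left ideal spanned by the b y_f, so the two sides can
be cancelled one after the other. -/
theorem eq_zero_of_mem_innerSpan {a : LeavittPathAlgebra F V} (ha : a ∈ innerSpan F V)
    (h : ∀ e f, y F V e * a * x F V f = 0) : a = 0 :=
  eq_zero_of_y_mul (innerSpan_le_left ha) fun e =>
    eq_zero_of_mul_x (mul_mem_span_mul_y _ (innerSpan_le_right ha)) (h e)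

theorem p_mem_innerSpan {a : V} (hfin : {e : Quiver.Total V | e.left = a}.Finite)
    (hne : {e : Quiver.Total V | e.left = a}.Nonempty) : p F V a ∈ innerSpan F V := by
  rw [isFamily.vertex_eq_sum a hfin hne]
  refine sum_mem fun e _ => Submodule.subset_span ⟨e, p F V e.right, e, ?_⟩
  rw [isFamily.x_mul_range]

end LocalUnits

/-! ### Descent on homogeneous elements of bounded length -/

section Homogeneous

variable {F : Type w} {V : Type u} [Field F] [Quiver.{v} V]

variable (F V) in
/-- The span of the monomials of degree `M - K` with at most `M` factors `x` (and hence at most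
`K` factors `y`). -/
noncomputable def bounded (M K : ℕ) : Submodule F (LeavittPathAlgebra F V) :=
  Submodule.span F {b | ∃ xs a ys, (xs.length ≤ M ∧ xs.length + K = ys.length + M) ∧
    mon F xs a ys = b}

theorem mon_mem_bounded {M K : ℕ} {xs : List (Quiver.Total V)} (a : V)
    {ys : List (Quiver.Total V)} (h : xs.length ≤ M) (h' : xs.length + K = ys.length + M) :
    mon F xs a ys ∈ bounded F V M K :=
  Submodule.subset_span ⟨xs, a, ys, ⟨h, h'⟩, rfl⟩

theorem bounded_mono {M K M' K' : ℕ} (h : M ≤ M') (h' : M + K' = M' + K) :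
    bounded F V M K ≤ bounded F V M' K' := by
  refine Submodule.span_le.2 ?_
  rintro _ ⟨xs, a, ys, ⟨h1, h2⟩, rfl⟩
  exact mon_mem_bounded a (by omega) (by omega)

/-- The degree M + 1 - K is positive, so every monomial has a leading x for y_e to cancel. -/
theorem y_mul_mem_bounded {M K : ℕ} (hKM : K ≤ M) {a : LeavittPathAlgebra F V}
    (ha : a ∈ bounded F V (M + 1) K) (e : Quiver.Total V) : y F V e * a ∈ bounded F V M K := by
  refine mul_mem_of_mon ?_ ha
  rintro _ ⟨xs, c, ys, ⟨h1, h2⟩, rfl⟩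
  rcases xs with _ | ⟨f, xs⟩
  · simp only [List.length_nil] at h2; omega
  · simp only [List.length_cons] at h1 h2
    rcases y_mul_mon_cons (F := F) e f xs c ys with h | h <;> rw [h]
    exacts [mon_mem_bounded c (by omega) (by omega), zero_mem _]

theorem mul_x_mem_bounded {M K : ℕ} (hMK : M ≤ K) {a : LeavittPathAlgebra F V}
    (ha : a ∈ bounded F V M (K + 1)) (e : Quiver.Total V) : a * x F V e ∈ bounded F V M K := by
  refine mul_mem_of_mon' ?_ ha
  rintro _ ⟨xs, c, ys, ⟨h1, h2⟩, rfl⟩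
  rcases ys with _ | ⟨f, ys⟩
  · simp only [List.length_nil] at h2; omega
  · simp only [List.length_cons] at h2
    rcases mon_cons_mul_x (F := F) e f xs c ys with h | h <;> rw [h]
    exacts [mon_mem_bounded c (by omega) (by omega), zero_mem _]

theorem y_mul_mul_x_mem_bounded {N : ℕ} {a : LeavittPathAlgebra F V}
    (ha : a ∈ bounded F V (N + 1) (N + 1)) (e f : Quiver.Total V) :
    y F V e * a * x F V f ∈ bounded F V N N := by
  refine mul_x_mem_bounded le_rfl (mul_mem_of_mon ?_ ha) f
  rintro _ ⟨xs, c, ys, ⟨h1, h2⟩, rfl⟩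
  rcases xs with _ | ⟨g, xs⟩
  · obtain rfl : ys = [] := List.eq_nil_of_length_eq_zero (by simp only [List.length_nil] at h2; omega)
    rw [mon_nil_nil]
    by_cases h : e.left = c
    · rw [← h, isFamily.y_mul_source, y_eq_mon]
      -- A bare vertex has no x to cancel: it becomes y_e, of degree -1, which fits in `bounded F V
      -- N (N + 1)` before the right factor x_f restores degree zero.
      exact mon_mem_bounded _ (by simp) (by simp; omega)
    · rw [y_mul_p_of_ne h]; exact zero_mem _
  · simp only [List.length_cons] at h1 h2
    rcases y_mul_mon_cons (F := F) e g xs c ys with h | h <;> rw [h]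
    exacts [mon_mem_bounded c (by omega) (by omega), zero_mem _]

theorem bounded_le_left {M K : ℕ} (h : K < M) :
    bounded F V M K ≤ Submodule.span F {c | ∃ e b, x F V e * b = c} := by
  refine Submodule.span_mono ?_
  rintro _ ⟨xs, c, ys, ⟨h1, h2⟩, rfl⟩
  rcases xs with _ | ⟨f, xs⟩
  · simp only [List.length_nil] at h2; omega
  · exact ⟨f, _, (mon_cons_left _ _ _ _).symm⟩

theorem bounded_le_right {M K : ℕ} (h : M < K) :
    bounded F V M K ≤ Submodule.span F {c | ∃ b f, b * y F V f = c} := by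
  refine Submodule.span_mono ?_
  rintro _ ⟨xs, c, ys, ⟨h1, h2⟩, rfl⟩
  rcases ys with _ | ⟨f, ys⟩
  · simp only [List.length_nil] at h2; omega
  · exact ⟨_, f, (mon_cons_right _ _ _ _).symm⟩

/-- In degree zero the x's and y's are equally many: either both are absent, or there is an outer
letter on each side. -/
theorem bounded_self_le (N : ℕ) :
    bounded F V N N ≤ Submodule.span F (Set.range (p F V)) ⊔ innerSpan F V := by
  refine Submodule.span_le.2 ?_
  rintro _ ⟨xs, c, ys, ⟨h1, h2⟩, rfl⟩
  rcases xs with _ | ⟨e, xs⟩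
  · obtain rfl : ys = [] := List.eq_nil_of_length_eq_zero (by simp only [List.length_nil] at h2; omega)
    rw [mon_nil_nil]
    exact Submodule.mem_sup_left (Submodule.subset_span ⟨c, rfl⟩)
  · rcases ys with _ | ⟨f, ys⟩
    · simp only [List.length_nil, List.length_cons] at h2; omega
    · refine Submodule.mem_sup_right (Submodule.subset_span ⟨e, mon F xs c ys, f, ?_⟩)
      rw [mon_cons_left, mon_cons_right, mul_assoc]

theorem p_mul_sum (γ : V →₀ F) (a : V) :
    p F V a * (γ.sum fun b t => t • p F V b) = γ a • p F V a := by
  classical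
  rw [Finsupp.sum, Finset.mul_sum, Finset.sum_eq_single a]
  · rw [mul_smul_comm, isFamily.p_mul_self]
  · intro b _ hb
    rw [mul_smul_comm, isFamily.p_mul_of_ne _ _ hb.symm, smul_zero]
  · intro h
    rw [Finsupp.notMem_support_iff.1 h, zero_smul, mul_zero]

variable {A : Type z} [NonUnitalRing A] [Module F A] {φ : LeavittPathAlgebra F V →ₙₐ[F] A}

/-- An element `∑ γ_v p_v + ∑ x_e b y_f` of the kernel lies in the span of the `x_e b y_f`. -/
theorem mem_innerSpan_of_map_eq_zero (hφ : ∀ a : V, φ (p F V a) ≠ 0)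
    {a : LeavittPathAlgebra F V}
    (ha : a ∈ Submodule.span F (Set.range (p F V)) ⊔ innerSpan F V) (h0 : φ a = 0) :
    a ∈ innerSpan F V := by
  obtain ⟨d, hd, c, hc, rfl⟩ := Submodule.mem_sup.1 ha
  obtain ⟨γ, rfl⟩ := Finsupp.mem_span_range_iff_exists_finsupp.1 hd
  obtain ⟨S, hS⟩ := exists_sum_mul_eq (innerSpan_le_left hc)
  have hc' := hS S subset_rfl
  refine add_mem (sum_mem fun b _ => ?_) hc
  have key : ∀ {t : F} {b' : V}, φ (t • p F V b') = 0 → t = 0 := fun {t b'} h => by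
    rw [map_smul] at h
    exact (smul_eq_zero.1 h).resolve_right (hφ b')
  by_cases hne : {e : Quiver.Total V | e.left = b}.Nonempty
  · by_cases hfin : {e : Quiver.Total V | e.left = b}.Finite
    · exact Submodule.smul_mem _ _ (p_mem_innerSpan hfin hne)
    -- At an infinite emitter, choose an edge e outside the finite set S supporting c. Then y_e c =
    -- 0, and the sandwich y_e · x_e isolates the coefficient of the vertex.
    · obtain ⟨e, rfl, heS⟩ := Set.Infinite.exists_notMem_finset hfin S
      have hyc : y F V e * c = 0 := by
        rw [← hc', Finset.mul_sum]
        refine Finset.sum_eq_zero fun f hf => ?_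
        rw [← mul_assoc, isFamily.y_mul_x_of_ne _ _ (fun h => heS (by rwa [h])), zero_mul]
      have hy : y F V e * (γ.sum (fun b t => t • p F V b) + c) * x F V e =
          γ e.left • p F V e.right := by
        rw [mul_add, hyc, add_zero, ← isFamily.y_mul_source, mul_assoc (y F V e), p_mul_sum,
          mul_smul_comm, isFamily.y_mul_source, smul_mul_assoc, isFamily.y_mul_x_self]
      have : γ e.left = 0 := key (by rw [← hy, map_mul, map_mul, h0, mul_zero, zero_mul])
      simp only [this, zero_smul]
      exact zero_mem _
  -- At a sink, p_b kills every x_f and hence c, so left multiplication by p_b isolates the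
  -- coefficient.
  · have hpc : p F V b * c = 0 := by
      rw [← hc', Finset.mul_sum]
      refine Finset.sum_eq_zero fun f _ => ?_
      rw [← mul_assoc, p_mul_x_of_ne (fun h => hne ⟨f, h.symm⟩), zero_mul]
    have hp : p F V b * (γ.sum (fun b t => t • p F V b) + c) = γ b • p F V b := by
      rw [mul_add, hpc, add_zero, p_mul_sum]
    have : γ b = 0 := key (by rw [← hp, map_mul, h0, mul_zero])
    simp only [this, zero_smul]
    exact zero_mem _

theorem eq_zero_of_mem_bounded_zero (hφ : ∀ a : V, φ (p F V a) ≠ 0)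
    {a : LeavittPathAlgebra F V} (ha : a ∈ bounded F V 0 0) (h0 : φ a = 0) : a = 0 := by
  have ha' : a ∈ Submodule.span F (Set.range (p F V)) := by
    refine (Submodule.span_le.2 ?_ : bounded F V 0 0 ≤ _) ha
    rintro _ ⟨xs, c, ys, ⟨h1, h2⟩, rfl⟩
    obtain rfl : xs = [] := List.eq_nil_of_length_eq_zero (by omega)
    obtain rfl : ys = [] := List.eq_nil_of_length_eq_zero (by simp only [List.length_nil] at h2; omega)
    rw [mon_nil_nil]
    exact Submodule.subset_span ⟨c, rfl⟩
  obtain ⟨γ, rfl⟩ := Finsupp.mem_span_range_iff_exists_finsupp.1 ha'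
  refine Finset.sum_eq_zero fun b _ => ?_
  have h : φ (γ b • p F V b) = 0 := by rw [← p_mul_sum, map_mul, h0, mul_zero]
  rw [map_smul] at h
  have : γ b = 0 := (smul_eq_zero.1 h).resolve_right (hφ b)
  simp only [this, zero_smul]

/-- Descent on M + K: cancelling an outer letter on the side dictated by the sign of the degree (on
both sides in degree zero) shortens the bounds and stays in the kernel. -/
theorem eq_zero_of_mem_bounded (hφ : ∀ a : V, φ (p F V a) ≠ 0) (n : ℕ) :
    ∀ (M K : ℕ), M + K = n → ∀ a ∈ bounded F V M K, φ a = 0 → a = 0 := by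
  induction n using Nat.strong_induction_on with
  | _ n ih =>
    rintro M K rfl a ha h0
    rcases lt_trichotomy M K with h | rfl | h
    · obtain ⟨K, rfl⟩ := Nat.exists_eq_succ_of_ne_zero (by omega : K ≠ 0)
      exact eq_zero_of_mul_x (bounded_le_right h ha) fun e =>
        ih (M + K) (by omega) M K rfl _ (mul_x_mem_bounded (by omega) ha e)
          (by rw [map_mul, h0, zero_mul])
    · rcases M with _ | N
      · exact eq_zero_of_mem_bounded_zero hφ ha h0
      · exact eq_zero_of_mem_innerSpan
          (mem_innerSpan_of_map_eq_zero hφ (bounded_self_le _ ha) h0) fun e f =>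
            ih (N + N) (by omega) N N rfl _ (y_mul_mul_x_mem_bounded ha e f)
              (by rw [map_mul, map_mul, h0, mul_zero, zero_mul])
    · obtain ⟨M, rfl⟩ := Nat.exists_eq_succ_of_ne_zero (by omega : M ≠ 0)
      exact eq_zero_of_y_mul (bounded_le_left h ha) fun e =>
        ih (M + K) (by omega) M K rfl _ (y_mul_mem_bounded (by omega) ha e)
          (by rw [map_mul, h0, mul_zero])

/-! ### Homogeneous components as gauge eigenspaces -/

variable (F V) in
/-- The homogeneous component of degree `n`: the span of the monomials of degree `n`. -/
noncomputable def homogeneous (n : ℤ) : Submodule F (LeavittPathAlgebra F V) :=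
  Submodule.span F {b | ∃ xs a ys, (xs.length : ℤ) - ys.length = n ∧ mon F xs a ys = b}

/-- Spanning suffices: independence of the components is never needed, since eigenvalues are
separated only after applying φ. -/
theorem iSup_homogeneous : ⨆ n, homogeneous F V n = ⊤ := by
  refine eq_top_iff.2 fun a _ => ?_
  refine (Submodule.span_le.2 ?_ : monSpan F V ≤ _) (mem_monSpan a)
  rintro _ ⟨xs, a, ys, rfl⟩
  exact Submodule.mem_iSup_of_mem _ (Submodule.subset_span ⟨xs, a, ys, rfl, rfl⟩)

theorem exists_mem_bounded {n : ℤ} {a : LeavittPathAlgebra F V} (ha : a ∈ homogeneous F V n) :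
    ∃ M K : ℕ, (M : ℤ) - K = n ∧ a ∈ bounded F V M K := by
  induction ha using Submodule.span_induction with
  | mem _ h =>
    obtain ⟨xs, c, ys, h, rfl⟩ := h
    exact ⟨_, _, h, mon_mem_bounded c le_rfl (add_comm _ _)⟩
  | zero => exact ⟨n.toNat, (-n).toNat, by omega, zero_mem _⟩
  | add a b _ _ iha ihb =>
    obtain ⟨M, K, h, ha⟩ := iha
    obtain ⟨M', K', h', hb⟩ := ihb
    -- M + M' dominates both bounds on the x's, and (M + M') - (M + K') = M' - K' = n keeps the
    -- degree.
    exact ⟨M + M', M + K', by omega, add_mem (bounded_mono (by omega) (by omega) ha)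
      (bounded_mono (by omega) (by omega) hb)⟩
  | smul t a _ ih =>
    obtain ⟨M, K, h, ha⟩ := ih
    exact ⟨M, K, h, Submodule.smul_mem _ t ha⟩

theorem eq_zero_of_mem_homogeneous (hφ : ∀ a : V, φ (p F V a) ≠ 0) {n : ℤ}
    {a : LeavittPathAlgebra F V} (ha : a ∈ homogeneous F V n) (h0 : φ a = 0) : a = 0 := by
  obtain ⟨M, K, -, ha⟩ := exists_mem_bounded ha
  exact eq_zero_of_mem_bounded hφ _ M K rfl a ha h0

theorem gaugeHom_mon (t : Fˣ) (xs : List (Quiver.Total V)) (a : V)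
    (ys : List (Quiver.Total V)) :
    gaugeHom F V t (mon F xs a ys) = (t ^ ((ys.length : ℤ) - xs.length)) • mon F xs a ys := by
  induction xs with
  | nil =>
    induction ys with
    | nil => simp [mon_nil_nil, gaugeHom]
    | cons f ys ih =>
      rw [mon_cons_right, map_mul, ih, gaugeHom, lift_y, Units.smul_def, Units.smul_def,
        smul_mul_assoc, mul_smul_comm, smul_smul, Units.smul_def, ← Units.val_mul,
        ← zpow_add_one]
      congr 3
  | cons e xs ih =>
    rw [mon_cons_left, map_mul, ih, gaugeHom, lift_x, Units.smul_def, Units.smul_def,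
      smul_mul_assoc, mul_smul_comm, smul_smul, Units.smul_def, ← Units.val_mul, mul_comm,
      ← zpow_sub_one]
    congr 3
    push_cast [List.length_cons]
    ring

theorem gaugeHom_of_mem_homogeneous (t : Fˣ) {n : ℤ} {a : LeavittPathAlgebra F V}
    (ha : a ∈ homogeneous F V n) : gaugeHom F V t a = (t ^ (-n)) • a := by
  induction ha using Submodule.span_induction with
  | mem _ h =>
    obtain ⟨xs, c, ys, rfl, rfl⟩ := h
    rw [gaugeHom_mon, neg_sub]
  | zero => rw [map_zero, smul_zero]
  | add a b _ _ iha ihb => rw [map_add, iha, ihb, smul_add]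
  | smul s a _ ih => rw [map_smul, ih, smul_comm]

end Homogeneous

end LeavittPathAlgebra

/-! ### Separating the components by eigenvalues -/

/-- Eigenvectors for distinct eigenvalues whose sum is zero are zero. -/
theorem eq_zero_of_sum_eigenvectors_eq_zero {F : Type u} {A : Type v} {ι : Type w} [Field F]
    [AddCommGroup A] [Module F A] (T : A →ₗ[F] A) (μ : ι → F) (s : Finset ι) :
    ∀ f : ι → A, Set.InjOn μ s → (∀ i ∈ s, T (f i) = μ i • f i) → ∑ i ∈ s, f i = 0 →
      ∀ i ∈ s, f i = 0 := by
  classical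
  induction s using Finset.induction_on with
  | empty => simp
  | insert k s hk ih =>
    intro f hμ hT hsum
    -- Applying T - μ_k to the vanishing sum removes the k-th term and rescales the others by
    -- nonzero scalars.
    have hsum' : ∑ i ∈ s, (μ i - μ k) • f i = 0 := by
      have h1 : ∑ i ∈ insert k s, (μ i - μ k) • f i = T (∑ i ∈ insert k s, f i) -
          μ k • ∑ i ∈ insert k s, f i := by
        rw [map_sum, Finset.smul_sum, ← Finset.sum_sub_distrib]
        exact Finset.sum_congr rfl fun i hi => by rw [hT i hi, sub_smul]
      rwa [hsum, map_zero, smul_zero, sub_zero, Finset.sum_insert hk, sub_self, zero_smul,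
        zero_add] at h1
    have hs : ∀ i ∈ s, f i = 0 := by
      intro i hi
      have h := ih (fun i => (μ i - μ k) • f i)
        (hμ.mono (Finset.coe_subset.2 (Finset.subset_insert k s)))
        (fun j hj => by rw [map_smul, hT j (Finset.mem_insert_of_mem hj), smul_comm])
        hsum' i hi
      refine (smul_eq_zero.1 h).resolve_left fun h => hk ?_
      have := hμ (Finset.mem_coe.2 (Finset.mem_insert_of_mem hi))
        (Finset.mem_coe.2 (Finset.mem_insert_self k s)) (sub_eq_zero.1 h)
      exact this ▸ hi
    intro i hi
    rcases Finset.mem_insert.1 hi with rfl | hi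
    · rwa [Finset.sum_insert hk, Finset.sum_eq_zero hs, add_zero] at hsum
    · exact hs i hi

/-- In an infinite field some unit has distinct powers for any finitely many exponents. -/
theorem exists_unit_zpow_injOn (F : Type u) [Field F] [Infinite F] (s : Finset ℤ) :
    ∃ t : Fˣ, Set.InjOn (fun n : ℤ => t ^ n) s := by
  classical
  have hroots : ∀ d : ℕ, d ≠ 0 → {t : Fˣ | t ^ d = 1}.Finite := by
    intro d hd
    have : NeZero d := ⟨hd⟩
    exact Set.finite_coe_iff.1 (inferInstance : Finite (rootsOfUnity d F))
  -- The bad t satisfy t^|m-n| = 1 for some m ≠ n in s: finitely many roots of unity, which cannot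
  -- exhaust the infinite group of units.
  have hfin : (⋃ q ∈ s.offDiag, {t : Fˣ | t ^ (q.1 - q.2).natAbs = 1}).Finite := by
    refine s.offDiag.finite_toSet.biUnion fun q hq => hroots _ ?_
    have := (Finset.mem_offDiag.1 hq).2.2
    omega
  have : Infinite {a : F // a ≠ 0} := (Set.finite_singleton (0 : F)).infinite_compl.to_subtype
  have : Infinite Fˣ := unitsEquivNeZero.infinite_iff.2 this
  obtain ⟨t, ht⟩ := hfin.exists_notMem
  refine ⟨t, fun m hm n hn hmn => ?_⟩
  by_contra hne
  refine ht (Set.mem_biUnion (x := (m, n)) (Finset.mem_offDiag.2 ⟨hm, hn, hne⟩) ?_)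
  have h : t ^ (m - n) = 1 := by rw [zpow_sub]; exact mul_inv_eq_one.2 hmn
  exact pow_natAbs_eq_one.2 h

open LeavittPathAlgebra in
/-- The gauge-invariant uniqueness theorem for the Leavitt path algebra of an arbitrary directed
graph over an infinite field. -/
theorem corollary6 (V : Type u) [Quiver.{v} V] (F : Type w) [Field F] [Infinite F]
    (A : Type z) [NonUnitalRing A] [Module F A] [IsScalarTower F A A] [SMulCommClass F A A]
    (φ : LeavittPathAlgebra F V →ₙₐ[F] A)
    (hφ : ∀ a : V, φ (LeavittPathAlgebra.p F V a) ≠ 0)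
    (σ : Fˣ →* algebraAut F A)
    (hσ : ∀ (t : Fˣ) (b : LeavittPathAlgebra F V),
      φ ((LeavittPathAlgebra.gaugeAction F V t : LeavittPathAlgebra F V ≃ₗ[F]
        LeavittPathAlgebra F V) b) = (σ t : A ≃ₗ[F] A) (φ b)) :
    Function.Injective φ := by
  refine (injective_iff_map_eq_zero φ).2 fun a h0 => ?_
  obtain ⟨g, hg, rfl⟩ := (Submodule.mem_iSup_iff_exists_finsupp _ a).1
    (iSup_homogeneous (F := F) (V := V) ▸ Submodule.mem_top)
  obtain ⟨t, ht⟩ := exists_unit_zpow_injOn F g.support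
  refine Finset.sum_eq_zero fun n hn => eq_zero_of_mem_homogeneous hφ (hg n) ?_
  -- By equivariance φ (g n) is an eigenvector of σ_t with eigenvalue t^(-n), the sign coming from
  -- x_e ↦ t⁻¹ x_e.
  refine eq_zero_of_sum_eigenvectors_eq_zero ((σ t : A ≃ₗ[F] A) : A →ₗ[F] A)
    (fun n : ℤ => ((t ^ (-n) : Fˣ) : F)) g.support (fun n => φ (g n)) ?_ ?_ ?_ n hn
  · intro m hm n hn hmn
    refine ht hm hn ?_
    have := Units.ext hmn
    rwa [zpow_neg, zpow_neg, inv_inj] at this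
  · intro m _
    have h : gaugeHom F V t (g m) = _ := gaugeHom_of_mem_homogeneous t (hg m)
    change (σ t : A ≃ₗ[F] A) (φ (g m)) = _
    rw [← hσ]
    change φ (gaugeHom F V t (g m)) = _
    rw [h, Units.smul_def, map_smul]
  · rw [← map_sum]
    exact h0
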